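/- Let $\tfrac12\le H_1<H_2<1$ (no further restriction on $H_2-H_1$). Put $$\gamma_{H_1}=\Bigl(2H_1(\tfrac32-H_1)\,\Gamma(\tfrac32-H_1)^3\,\Gamma(H_1+\tfrac12)\,\Gamma(3-2H_1)^{-1}\Bigr)^{1/2},\qquad \beta_{H_2}=\Bigl(\frac{H_2(2H_2-1)}{\mathrm B(H_2-\frac12,\,2-2H_2)}\Bigr)^{1/2},$$ where $\Gamma$ is the gamma function and $\mathrm B(a,b)=\int_0^1x^{a-1}(1-x)^{b-1}\,dx$ is the beta function. For $0<s<t$ let $$K(t,s)=\beta_{H_2}\,s^{1/2-H_2}\int_s^t (t-u)^{1/2-H_1}\,u^{H_2-H_1}\,(u-s)^{H_2-3/2}\,du ,$$ let $$k(s,u)=\int_0^{s\wedge u}\partial_sK(s,v)\,\partial_uK(u,v)\,dv ,\qquad s,u>0,\ s\ne u,$$ and let $\kappa(s,u)=u^{2H_1-1}k(s,u)$ for $u>0$, extended to $u=0$ by continuity, $\kappa(s,0)=\lim_{w\downarrow0}\kappa(s,w)$ for $s>0$ (values on the null set $\{s=u\}\cup\{s=0\}$ play no role). Then there is a sequence of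 positive numbers $T_n\to\infty$ such that, for every $n$, the Fredholm integral equation of the second kind $$h(u)+\frac1{\gamma_{H_1}^{2}}\int_0^{T_n}h(s)\,\kappa(s,u)\,ds=1,\qquad u\in[0,T_n],$$ has a unique solution $h\in C[0,T_n]$. -/

import Mathlib

noncomputable section

namespace MixedFBM

open MeasureTheory Filter Topology

/-- The constant `γ_H = (2H (3/2 - H) Γ(3/2 - H)³ Γ(H + 1/2) / Γ(3 - 2H)) ^ (1/2)`. -/
def gammaConst (H : ℝ) : ℝ :=
  Real.sqrt (2 * H * (3 / 2 - H) * Real.Gamma (3 / 2 - H) ^ 3 * Real.Gamma (H + 1 / 2) /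
    Real.Gamma (3 - 2 * H))

/-- Euler's beta function `B(a, b) = ∫₀¹ x^(a-1) (1-x)^(b-1) dx` for real `a, b > 0`. -/
def betaFn (a b : ℝ) : ℝ :=
  ∫ x in (0 : ℝ)..1, x ^ (a - 1) * (1 - x) ^ (b - 1)

/-- The constant `β_H = (H (2H - 1) / B(H - 1/2, 2 - 2H)) ^ (1/2)`. -/
def betaConst (H : ℝ) : ℝ :=
  Real.sqrt (H * (2 * H - 1) / betaFn (H - 1 / 2) (2 - 2 * H))

/-- The Volterra kernel
`K_{H₁,H₂}(t, s) = β_{H₂} s^(1/2-H₂) ∫ₛᵗ (t-u)^(1/2-H₁) u^(H₂-H₁) (u-s)^(H₂-3/2) du`,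
for `0 < s < t`. -/
def volterraKernel (H₁ H₂ t s : ℝ) : ℝ :=
  betaConst H₂ * s ^ (1 / 2 - H₂) *
    ∫ u in s..t, (t - u) ^ (1 / 2 - H₁) * u ^ (H₂ - H₁) * (u - s) ^ (H₂ - 3 / 2)

/-- The kernel `k(s, u) = ∫₀^{s ∧ u} ∂ₛK_{H₁,H₂}(s, v) ∂ᵤK_{H₁,H₂}(u, v) dv`. -/
def kernelK (H₁ H₂ s u : ℝ) : ℝ :=
  ∫ v in (0 : ℝ)..(min s u),
    deriv (fun t => volterraKernel H₁ H₂ t v) s * deriv (fun t => volterraKernel H₁ H₂ t v) u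

/-- The kernel `κ(s, u) = u^(2H₁-1) k(s, u)` for `u > 0`, extended to `u = 0` by continuity:
`κ(s, 0) = lim_{w ↓ 0} w^(2H₁-1) k(s, w)`. (The formula `u^(2H₁-1) k(s, u)` read literally at
`u = 0` is an integral over an empty interval and is not the continuous value.) -/
def kappa (H₁ H₂ s u : ℝ) : ℝ :=
  if u = 0 then limUnder (𝓝[>] (0 : ℝ)) (fun w => w ^ (2 * H₁ - 1) * kernelK H₁ H₂ s w)
  else u ^ (2 * H₁ - 1) * kernelK H₁ H₂ s u

/-- `h ∈ C[0,T]` solves `h(u) + γ_{H₁}⁻² ∫₀ᵀ h(s) κ(s, u) ds = 1` for all `u ∈ [0,T]`; the integral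
(with respect to Lebesgue measure on `[0,T]`) is required to exist. -/
def IsFredholmSolution (H₁ H₂ T : ℝ) (h : C(Set.Icc (0 : ℝ) T, ℝ)) : Prop :=
  ∀ u : Set.Icc (0 : ℝ) T,
    Integrable (fun s : Set.Icc (0 : ℝ) T => h s * kappa H₁ H₂ s u)
        ((volume : Measure ℝ).comap Subtype.val) ∧
      h u + 1 / gammaConst H₁ ^ 2 *
        ∫ s : Set.Icc (0 : ℝ) T, h s * kappa H₁ H₂ s u ∂((volume : Measure ℝ).comap Subtype.val)
          = 1

end MixedFBM

end

namespace MixedFBM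

open MeasureTheory Filter Topology Set

/-- An integral operator on `C(X, ℝ)` whose kernel is continuous into `L¹` is compact. -/
theorem exists_isCompactOperator_integral {X : Type*} [TopologicalSpace X] [CompactSpace X]
    [MeasurableSpace X] [OpensMeasurableSpace X] {μ : Measure X} (b : X → X → ℝ)
    (hb : ∀ v, Integrable (b v) μ)
    (hcont : ∀ v, Tendsto (fun v' => ∫ s, |b v' s - b v s| ∂μ) (𝓝 v) (𝓝 0)) :
    ∃ B : C(X, ℝ) →L[ℝ] C(X, ℝ), IsCompactOperator B ∧
      ∀ h v, B h v = ∫ s, h s * b v s ∂μ := by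
  have hint : ∀ (h : C(X, ℝ)) v, Integrable (fun s => h s * b v s) μ := fun h v =>
    (hb v).bdd_mul h.continuous.aestronglyMeasurable (ae_of_all _ fun s => h.norm_coe_le_norm s)
  have hbound : ∀ (h : C(X, ℝ)) v, |∫ s, h s * b v s ∂μ| ≤ ‖h‖ * ∫ s, |b v s| ∂μ := by
    intro h v
    rw [← integral_const_mul]
    refine (norm_integral_le_integral_norm _).trans
      (integral_mono (hint h v).norm ((hb v).abs.const_mul _) fun s => ?_)
    simp only [norm_mul]
    exact mul_le_mul_of_nonneg_right (h.norm_coe_le_norm s) (norm_nonneg _)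
  have hdiff : ∀ (h : C(X, ℝ)) v v', |(∫ s, h s * b v' s ∂μ) - ∫ s, h s * b v s ∂μ| ≤
      ‖h‖ * ∫ s, |b v' s - b v s| ∂μ := by
    intro h v v'
    rw [← integral_const_mul, ← integral_sub (hint h v') (hint h v)]
    refine (norm_integral_le_integral_norm _).trans
      (integral_mono ((hint h v').sub (hint h v)).norm
        (((hb v').sub (hb v)).abs.const_mul _) fun s => ?_)
    change ‖h s * b v' s - h s * b v s‖ ≤ ‖h‖ * |b v' s - b v s|
    rw [← mul_sub, norm_mul]
    exact mul_le_mul_of_nonneg_right (h.norm_coe_le_norm s) (norm_nonneg _)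
  have hc : ∀ h : C(X, ℝ), Continuous fun v => ∫ s, h s * b v s ∂μ := by
    intro h
    refine continuous_iff_continuousAt.2 fun v => tendsto_iff_dist_tendsto_zero.2 ?_
    refine squeeze_zero (fun _ => dist_nonneg) (fun v' => hdiff h v v') ?_
    simpa using (hcont v).const_mul ‖h‖
  let B : C(X, ℝ) →ₗ[ℝ] C(X, ℝ) :=
    { toFun := fun h => ⟨fun v => ∫ s, h s * b v s ∂μ, hc h⟩
      map_add' := fun f g => by
        ext v
        simp only [ContinuousMap.add_apply, add_mul, ContinuousMap.coe_mk]
        exact integral_add (hint f v) (hint g v)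
      map_smul' := fun a f => by
        ext v
        simp only [ContinuousMap.smul_apply, smul_eq_mul, mul_assoc, ContinuousMap.coe_mk,
          RingHom.id_apply]
        exact integral_const_mul _ _ }
  have hB : ∀ h v, B h v = ∫ s, h s * b v s ∂μ := fun h v => rfl
  have hcomp : IsCompactOperator B := by
    refine (isCompactOperator_iff_image_closedBall_subset_compact B one_pos).2 ?_
    let P : Set (X → ℝ) := {f | ∀ v, |f v| ≤ ∫ s, |b v s| ∂μ} ∩
      {f | ∀ v v', |f v' - f v| ≤ ∫ s, |b v' s - b v s| ∂μ}
    have hP : ∀ f ∈ P, Continuous f := by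
      intro f hf
      refine continuous_iff_continuousAt.2 fun v => tendsto_iff_dist_tendsto_zero.2 ?_
      exact squeeze_zero (fun _ => dist_nonneg) (fun v' => hf.2 v v') (hcont v)
    refine ⟨{f : C(X, ℝ) | (f : X → ℝ) ∈ P}, ArzelaAscoli.isCompact_of_equicontinuous _ ?_ ?_, ?_⟩
    · have himg : ContinuousMap.toFun '' {f : C(X, ℝ) | (f : X → ℝ) ∈ P} = P := by
        ext f
        exact ⟨fun ⟨g, hg, hgf⟩ => hgf ▸ hg, fun hf => ⟨⟨f, hP f hf⟩, hf, rfl⟩⟩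
      rw [himg]
      refine (isCompact_univ_pi (fun v => isCompact_Icc (a := -∫ s, |b v s| ∂μ)
        (b := ∫ s, |b v s| ∂μ))).of_isClosed_subset ?_ fun f hf v _ => abs_le.1 (hf.1 v)
      refine IsClosed.inter ?_ ?_
      · simp only [ofPred_forall]
        exact isClosed_iInter fun v => isClosed_le (by fun_prop) continuous_const
      · simp only [ofPred_forall]
        exact isClosed_iInter fun v => isClosed_iInter fun v' =>
          isClosed_le (by fun_prop) continuous_const
    · intro v
      refine Metric.equicontinuousAt_iff_right.2 fun ε hε => ?_
      filter_upwards [(tendsto_order.1 (hcont v)).2 ε hε] with v' hv' f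
      rw [dist_comm]
      exact (f.2.2 v v').trans_lt hv'
    · rintro _ ⟨h, hh, rfl⟩
      have hh1 : ‖h‖ ≤ 1 := by simpa using hh
      refine ⟨fun v => (hbound h v).trans ?_, fun v v' => (hdiff h v v').trans ?_⟩ <;>
      exact mul_le_of_le_one_left (integral_nonneg fun _ => abs_nonneg _) hh1
  exact ⟨ContinuousLinearMap.mkOfIsCompactOperator hcomp, hcomp, fun h v => rfl⟩

/-- The Volterra kernel `(s - v) ^ a * Q v (s - v)`, supported on `v < s`. -/
noncomputable def singularKernel (a : ℝ) (Q : ℝ → ℝ → ℝ) (v s : ℝ) : ℝ :=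
  if v < s then (s - v) ^ a * Q v (s - v) else 0

/-- A continuous cutoff of `w ↦ w ^ a` on `w > 0`. -/
noncomputable def cutoffPow (a ε w : ℝ) : ℝ := max w 0 * max w ε ^ (a - 1)

theorem continuous_cutoffPow {a ε : ℝ} (hε : 0 < ε) : Continuous (cutoffPow a ε) := by
  unfold cutoffPow
  refine (continuous_id.max continuous_const).mul ?_
  exact (continuous_id.max continuous_const).rpow_const fun w =>
    Or.inl (hε.trans_le (le_max_right _ _)).ne'

theorem abs_sub_cutoffPow_le {a ε : ℝ} (ha : a ≤ 0) (w : ℝ) :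
    |(if 0 < w then w ^ a else 0) - cutoffPow a ε w| ≤ (Ioo 0 ε).indicator (fun w => w ^ a) w := by
  unfold cutoffPow
  by_cases hw : 0 < w
  · rcases lt_or_ge w ε with h | h
    · rw [indicator_of_mem (show w ∈ Ioo 0 ε from ⟨hw, h⟩), if_pos hw, max_eq_left hw.le,
        max_eq_right h.le]
      have h1 : w * ε ^ (a - 1) ≤ w ^ a := by
        calc w * ε ^ (a - 1) ≤ w * w ^ (a - 1) := by
              refine mul_le_mul_of_nonneg_left ?_ hw.le
              exact Real.rpow_le_rpow_of_nonpos hw h.le (by linarith)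
          _ = w ^ a := by rw [Real.rpow_sub_one hw.ne']; field_simp
      have h2 : 0 ≤ w * ε ^ (a - 1) := mul_nonneg hw.le (Real.rpow_nonneg (hw.trans h).le _)
      rw [abs_of_nonneg (by linarith)]
      linarith
    · rw [indicator_of_notMem (fun hh => absurd hh.2 (not_lt.2 h)), if_pos hw, max_eq_left hw.le,
        max_eq_left h, Real.rpow_sub_one hw.ne']
      refine le_of_eq ?_
      rw [abs_eq_zero]
      field_simp
      simp
  · rw [indicator_of_notMem (fun hh => hw hh.1), if_neg hw, max_eq_right (not_lt.1 hw)]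
    simp

theorem integrableOn_rpow_Ioo {a ε : ℝ} (ha : -1 < a) (hε : 0 ≤ ε) :
    IntegrableOn (fun w : ℝ => w ^ a) (Ioo 0 ε) := by
  rw [← intervalIntegrable_iff_integrableOn_Ioo_of_le hε]
  exact intervalIntegral.intervalIntegrable_rpow' ha

theorem tendsto_setIntegral_rpow_Ioo {a : ℝ} (ha : -1 < a) :
    Tendsto (fun ε : ℝ => ∫ w in Ioo 0 ε, w ^ a) (𝓝[>] 0) (𝓝 0) := by
  have h1 : Tendsto (fun ε : ℝ => ε ^ (a + 1) / (a + 1)) (𝓝[>] 0) (𝓝 0) := by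
    have h2 : ContinuousAt (fun ε : ℝ => ε ^ (a + 1)) 0 :=
      Real.continuousAt_rpow_const _ _ (Or.inr (by linarith))
    have h3 := (h2.tendsto.div_const (a + 1)).mono_left (nhdsWithin_le_nhds (s := Ioi 0))
    rwa [Real.zero_rpow (by linarith), zero_div] at h3
  refine h1.congr' ?_
  filter_upwards [self_mem_nhdsWithin] with ε hε
  rw [← integral_Ioc_eq_integral_Ioo, ← intervalIntegral.integral_of_le (le_of_lt hε),
    integral_rpow (Or.inl ha), Real.zero_rpow (by linarith), sub_zero]

theorem measurable_singularKernel {a : ℝ} {Q : ℝ → ℝ → ℝ}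
    (hQ : Continuous (Function.uncurry Q)) :
    Measurable (Function.uncurry (singularKernel a Q)) := by
  unfold singularKernel Function.uncurry
  refine Measurable.ite (measurableSet_lt measurable_fst measurable_snd) ?_ measurable_const
  refine Measurable.mul ((measurable_snd.sub measurable_fst).pow_const _) ?_
  exact hQ.measurable.comp (measurable_fst.prodMk (measurable_snd.sub measurable_fst))

theorem singularKernel_eq (a : ℝ) (Q : ℝ → ℝ → ℝ) (v s : ℝ) :
    singularKernel a Q v s = (if 0 < s - v then (s - v) ^ a else 0) * Q v (s - v) := by
  unfold singularKernel
  by_cases h : v < s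
  · rw [if_pos h, if_pos (sub_pos.2 h)]
  · rw [if_neg h, if_neg (fun h' => h (sub_pos.1 h')), zero_mul]

section

variable {a T M : ℝ} {Q : ℝ → ℝ → ℝ}

theorem abs_singularKernel_sub_cutoff_le (ha0 : a ≤ 0)
    (hM : ∀ v ∈ Icc 0 T, ∀ w ∈ Icc (-T) T, |Q v w| ≤ M) {ε v s : ℝ}
    (hv : v ∈ Icc 0 T) (hs : s ∈ Icc 0 T) :
    |singularKernel a Q v s - cutoffPow a ε (s - v) * Q v (s - v)| ≤
      M * (Ioo 0 ε).indicator (fun w => w ^ a) (s - v) := by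
  rw [singularKernel_eq, ← sub_mul, abs_mul, mul_comm]
  have hM' := hM v hv (s - v) ⟨by linarith [hv.2, hs.1], by linarith [hv.1, hs.2]⟩
  exact mul_le_mul hM' (abs_sub_cutoffPow_le ha0 _) (abs_nonneg _) ((abs_nonneg _).trans hM')

theorem exists_bound_of_continuous (hQ : Continuous (Function.uncurry Q)) (T : ℝ) :
    ∃ M, 0 ≤ M ∧ ∀ v ∈ Icc 0 T, ∀ w ∈ Icc (-T) T, |Q v w| ≤ M := by
  obtain ⟨M, hM⟩ := ((isCompact_Icc (a := (0 : ℝ)) (b := T)).prod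
    (isCompact_Icc (a := -T) (b := T))).exists_bound_of_continuousOn hQ.continuousOn
  exact ⟨max M 0, le_max_right _ _, fun v hv w hw => (hM (v, w) ⟨hv, hw⟩).trans (le_max_left _ _)⟩

theorem integrable_indicator_comp_sub (ha : -1 < a) {ε : ℝ} (hε : 0 ≤ ε) (v : ℝ) :
    Integrable fun s => (Ioo 0 ε).indicator (fun w : ℝ => w ^ a) (s - v) :=
  (((integrable_indicator_iff measurableSet_Ioo).2
    (integrableOn_rpow_Ioo ha hε)).comp_sub_right v)

theorem continuous_cutoff_kernel (hQ : Continuous (Function.uncurry Q)) {ε : ℝ} (hε : 0 < ε) :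
    Continuous fun p : ℝ × ℝ => cutoffPow a ε (p.2 - p.1) * Q p.1 (p.2 - p.1) :=
  ((continuous_cutoffPow hε).comp (continuous_snd.sub continuous_fst)).mul
    (hQ.comp (continuous_fst.prodMk (continuous_snd.sub continuous_fst)))

theorem integrableOn_singularKernel_sub_cutoff (ha : -1 < a) (ha0 : a ≤ 0)
    (hQ : Continuous (Function.uncurry Q)) {ε v : ℝ} (hε : 0 < ε) (hv : v ∈ Icc 0 T) :
    IntegrableOn (fun s => singularKernel a Q v s - cutoffPow a ε (s - v) * Q v (s - v))
      (Icc 0 T) := by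
  obtain ⟨M, -, hM⟩ := exists_bound_of_continuous hQ T
  refine Integrable.mono' ((integrable_indicator_comp_sub ha hε.le v).const_mul M).integrableOn ?_ ?_
  · exact (((measurable_singularKernel hQ).comp measurable_prodMk_left).sub
      ((continuous_cutoff_kernel hQ hε).comp
        (Continuous.prodMk_right v)).measurable).aestronglyMeasurable
  · filter_upwards [ae_restrict_mem measurableSet_Icc] with s hs
    exact abs_singularKernel_sub_cutoff_le ha0 hM hv hs

theorem setIntegral_singularKernel_sub_cutoff_le (ha : -1 < a) (ha0 : a ≤ 0)
    (hQ : Continuous (Function.uncurry Q)) (hM0 : 0 ≤ M)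
    (hM : ∀ v ∈ Icc 0 T, ∀ w ∈ Icc (-T) T, |Q v w| ≤ M) {ε v : ℝ} (hε : 0 < ε)
    (hv : v ∈ Icc 0 T) :
    ∫ s in Icc 0 T, |singularKernel a Q v s - cutoffPow a ε (s - v) * Q v (s - v)| ≤
      M * ∫ w in Ioo 0 ε, w ^ a := by
  calc _ ≤ ∫ s in Icc 0 T, M * (Ioo 0 ε).indicator (fun w => w ^ a) (s - v) := by
        refine setIntegral_mono_on (integrableOn_singularKernel_sub_cutoff ha ha0 hQ hε hv).abs
          ((integrable_indicator_comp_sub ha hε.le v).const_mul M).integrableOn measurableSet_Icc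
          fun s hs => abs_singularKernel_sub_cutoff_le ha0 hM hv hs
    _ ≤ ∫ s, M * (Ioo 0 ε).indicator (fun w => w ^ a) (s - v) := by
        refine setIntegral_le_integral
          ((integrable_indicator_comp_sub ha hε.le v).const_mul M) (ae_of_all _ fun s => ?_)
        exact mul_nonneg hM0 (indicator_nonneg (fun w hw => Real.rpow_nonneg hw.1.le _) _)
    _ = M * ∫ w in Ioo 0 ε, w ^ a := by
        rw [integral_const_mul, integral_sub_right_eq_self
          (fun w => (Ioo 0 ε).indicator (fun w : ℝ => w ^ a) w), integral_indicator measurableSet_Ioo]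

theorem integrableOn_singularKernel (ha : -1 < a) (ha0 : a ≤ 0)
    (hQ : Continuous (Function.uncurry Q)) {v : ℝ} (hv : v ∈ Icc 0 T) :
    IntegrableOn (singularKernel a Q v) (Icc 0 T) := by
  have h1 := integrableOn_singularKernel_sub_cutoff (T := T) ha ha0 hQ one_pos hv
  have h2 : IntegrableOn (fun s => cutoffPow a 1 (s - v) * Q v (s - v)) (Icc 0 T) :=
    ((continuous_cutoff_kernel hQ one_pos).comp
      (Continuous.prodMk_right v)).continuousOn.integrableOn_compact isCompact_Icc
  refine (h1.add h2).congr (ae_of_all _ fun s => ?_)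
  simp

theorem tendsto_setIntegral_abs_singularKernel_sub (ha : -1 < a) (ha0 : a ≤ 0)
    (hQ : Continuous (Function.uncurry Q)) {v : ℝ} (hv : v ∈ Icc 0 T) :
    Tendsto (fun v' => ∫ s in Icc 0 T, |singularKernel a Q v' s - singularKernel a Q v s|)
      (𝓝[Icc 0 T] v) (𝓝 0) := by
  obtain ⟨M, hM0, hM⟩ := exists_bound_of_continuous hQ T
  refine tendsto_order.2 ⟨fun η hη => Eventually.of_forall fun v' =>
    hη.trans_le (integral_nonneg fun _ => abs_nonneg _), fun η hη => ?_⟩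
  have hlim := (tendsto_setIntegral_rpow_Ioo ha).const_mul M
  rw [mul_zero] at hlim
  obtain ⟨ε, hεη, hε⟩ := (((tendsto_order.1 hlim).2 (η / 3) (by positivity)).and
    self_mem_nhdsWithin).exists
  have hε : 0 < ε := hε
  let c : ℝ → ℝ → ℝ := fun v s => cutoffPow a ε (s - v) * Q v (s - v)
  have hc : Continuous (Function.uncurry c) := continuous_cutoff_kernel hQ hε
  have hmid : Continuous fun v' => ∫ s in Icc 0 T, |c v' s - c v s| := by
    refine continuous_parametric_integral_of_continuous (f := fun v' s => |c v' s - c v s|)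
      ?_ isCompact_Icc
    exact (hc.sub (hc.comp ((continuous_const (y := v)).prodMk continuous_snd))).abs
  have hmid0 : ∀ᶠ v' in 𝓝[Icc 0 T] v, ∫ s in Icc 0 T, |c v' s - c v s| < η / 3 := by
    have := hmid.tendsto v
    simp only [sub_self, abs_zero, integral_zero] at this
    exact ((tendsto_order.1 this).2 (η / 3) (by positivity)).filter_mono nhdsWithin_le_nhds
  filter_upwards [hmid0, self_mem_nhdsWithin] with v' hv'1 hv'
  have i1 : IntegrableOn (fun s => |singularKernel a Q v' s - c v' s|) (Icc 0 T) :=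
    (integrableOn_singularKernel_sub_cutoff ha ha0 hQ hε hv').abs
  have i3 : IntegrableOn (fun s => |singularKernel a Q v s - c v s|) (Icc 0 T) :=
    (integrableOn_singularKernel_sub_cutoff ha ha0 hQ hε hv).abs
  have i2 : IntegrableOn (fun s => |c v' s - c v s|) (Icc 0 T) :=
    ((hc.comp (Continuous.prodMk_right v')).sub
      (hc.comp (Continuous.prodMk_right v))).abs.continuousOn.integrableOn_compact isCompact_Icc
  have e1 := setIntegral_singularKernel_sub_cutoff_le ha ha0 hQ hM0 hM hε hv'
  have e3 := setIntegral_singularKernel_sub_cutoff_le ha ha0 hQ hM0 hM hε hv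
  have key : ∫ s in Icc 0 T, |singularKernel a Q v' s - singularKernel a Q v s| ≤
      (∫ s in Icc 0 T, |singularKernel a Q v' s - c v' s|) +
        (∫ s in Icc 0 T, |c v' s - c v s|) + ∫ s in Icc 0 T, |singularKernel a Q v s - c v s| := by
    have i12 : IntegrableOn (fun s => |singularKernel a Q v' s - c v' s| + |c v' s - c v s|)
      (Icc 0 T) := i1.add i2
    rw [← integral_add i1 i2, ← integral_add i12 i3]
    refine integral_mono ((integrableOn_singularKernel ha ha0 hQ hv').sub
      (integrableOn_singularKernel ha ha0 hQ hv)).abs (i12.add i3) fun s => ?_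
    change |singularKernel a Q v' s - singularKernel a Q v s| ≤
      |singularKernel a Q v' s - c v' s| + |c v' s - c v s| + |singularKernel a Q v s - c v s|
    rw [abs_sub_comm (singularKernel a Q v s)]
    exact (abs_sub_le _ (c v s) _).trans (by gcongr; exact abs_sub_le _ _ _)
  change (∫ s in Icc 0 T, |singularKernel a Q v' s - c v' s|) ≤ _ at e1
  change (∫ s in Icc 0 T, |singularKernel a Q v s - c v s|) ≤ _ at e3
  linarith

/-- The Volterra operator with kernel `singularKernel a Q` is compact on `C([0, T])`. -/
theorem exists_isCompactOperator_singularKernel (ha : -1 < a) (ha0 : a ≤ 0)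
    (hQ : Continuous (Function.uncurry Q)) (T : ℝ) :
    ∃ B : C(Icc (0 : ℝ) T, ℝ) →L[ℝ] C(Icc (0 : ℝ) T, ℝ), IsCompactOperator B ∧
      ∀ h v, B h v = ∫ s : Icc (0 : ℝ) T, h s * singularKernel a Q v s
        ∂((volume : Measure ℝ).comap Subtype.val) := by
  refine exists_isCompactOperator_integral (fun v s : Icc (0 : ℝ) T => singularKernel a Q v s)
    (fun v => ?_) fun v => ?_
  · exact (integrableOn_iff_comap_subtypeVal measurableSet_Icc).1
      (integrableOn_singularKernel ha ha0 hQ v.2)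
  · have h := tendsto_setIntegral_abs_singularKernel_sub ha ha0 hQ v.2
    rw [nhdsWithin_eq_map_subtype_coe v.2, tendsto_map'_iff] at h
    refine h.congr fun v' => ?_
    exact (integral_subtype_comap measurableSet_Icc
      fun s => |singularKernel a Q v' s - singularKernel a Q v s|).symm

end

theorem intervalIntegrable_beta_weight {a b : ℝ} (ha : -1 < a) (hb : -1 < b) :
    IntervalIntegrable (fun x : ℝ => (1 - x) ^ a * x ^ b) volume 0 1 := by
  have h := (Complex.betaIntegral_convergent (u := ((b + 1 : ℝ) : ℂ)) (v := ((a + 1 : ℝ) : ℂ))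
    (by rw [Complex.ofReal_re]; linarith) (by rw [Complex.ofReal_re]; linarith)).norm
  rw [intervalIntegrable_iff_integrableOn_Ioo_of_le zero_le_one] at h ⊢
  refine h.congr_fun (fun x hx => ?_) measurableSet_Ioo
  have h1 : (1 - (x : ℂ)) = ((1 - x : ℝ) : ℂ) := by push_cast; ring
  simp only [norm_mul]
  rw [h1, Complex.norm_cpow_eq_rpow_re_of_pos hx.1,
    Complex.norm_cpow_eq_rpow_re_of_pos (sub_pos.2 hx.2), mul_comm]
  simp

theorem rpow_sub_one_mul_add_le {d p q : ℝ} (hd : 0 < d) (hp : 0 ≤ p) (hq : 0 ≤ q) :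
    (p + q) ^ (d - 1) * (p + 2 * q) ≤ 2 * (p + q) ^ d := by
  rcases (add_nonneg hp hq).eq_or_lt with h | h
  · have hp0 : p = 0 := by linarith
    have hq0 : q = 0 := by linarith
    simp [hp0, hq0, Real.zero_rpow hd.ne']
  · calc (p + q) ^ (d - 1) * (p + 2 * q) ≤ (p + q) ^ (d - 1) * (2 * (p + q)) :=
          mul_le_mul_of_nonneg_left (by linarith) (Real.rpow_nonneg h.le _)
      _ = 2 * (p + q) ^ d := by rw [Real.rpow_sub_one h.ne']; field_simp

theorem continuous_rpow_sub_one_mul_add {d : ℝ} (hd : 0 < d) :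
    Continuous fun p : ℝ × ℝ => (|p.1| + |p.2|) ^ (d - 1) * (|p.1| + 2 * |p.2|) := by
  refine continuous_iff_continuousAt.2 fun p => ?_
  rcases (add_nonneg (abs_nonneg p.1) (abs_nonneg p.2)).eq_or_lt with h | h
  · have h1 : |p.1| = 0 := by linarith [abs_nonneg p.1, abs_nonneg p.2]
    have h2 : |p.2| = 0 := by linarith [abs_nonneg p.1, abs_nonneg p.2]
    have hlim : Tendsto (fun p : ℝ × ℝ => 2 * (|p.1| + |p.2|) ^ d) (𝓝 p) (𝓝 0) := by
      have : Continuous fun p : ℝ × ℝ => 2 * (|p.1| + |p.2|) ^ d :=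
        continuous_const.mul ((by fun_prop : Continuous fun p : ℝ × ℝ => |p.1| + |p.2|).rpow_const
          fun _ => Or.inr hd.le)
      have := this.tendsto p
      rwa [← h, Real.zero_rpow hd.ne', mul_zero] at this
    rw [ContinuousAt, h1, h2]
    simp only [mul_zero, add_zero]
    exact squeeze_zero (fun _ => by positivity)
      (fun q => rpow_sub_one_mul_add_le hd (abs_nonneg _) (abs_nonneg _)) hlim
  · refine ContinuousAt.mul ?_ (by fun_prop)
    exact ContinuousAt.rpow_const (by fun_prop) (Or.inl h.ne')

/-- The regular factor of `∂K/∂t`, as a function of `v` and of the lag `w = t - v`. -/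
noncomputable def profile (H₁ H₂ v w : ℝ) : ℝ :=
  ∫ x in (0 : ℝ)..1, (1 - x) ^ (1 / 2 - H₁) * x ^ (H₂ - 3 / 2) *
    ((|v| + |w * x|) ^ (H₂ - H₁ - 1) * (|v| + 2 * |w * x|))

section

variable {H₁ H₂ : ℝ}

theorem intervalIntegrable_weight (hH₁ : 1 / 2 ≤ H₁) (hH₁₂ : H₁ < H₂) (hH₂ : H₂ < 1) :
    IntervalIntegrable (fun x : ℝ => (1 - x) ^ (1 / 2 - H₁) * x ^ (H₂ - 3 / 2)) volume 0 1 :=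
  intervalIntegrable_beta_weight (by linarith) (by linarith)

theorem aestronglyMeasurable_weight (hH₁ : 1 / 2 ≤ H₁) (hH₁₂ : H₁ < H₂) (hH₂ : H₂ < 1) :
    AEStronglyMeasurable (fun x : ℝ => (1 - x) ^ (1 / 2 - H₁) * x ^ (H₂ - 3 / 2))
      (volume.restrict (uIoc 0 1)) := by
  rw [uIoc_of_le zero_le_one]
  exact (intervalIntegrable_weight hH₁ hH₁₂ hH₂).1.aestronglyMeasurable

theorem continuous_profile (hH₁ : 1 / 2 ≤ H₁) (hH₁₂ : H₁ < H₂) (hH₂ : H₂ < 1) :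
    Continuous (Function.uncurry (profile H₁ H₂)) := by
  have hd : 0 < H₂ - H₁ := sub_pos.2 hH₁₂
  have hω := intervalIntegrable_weight hH₁ hH₁₂ hH₂
  have hf : Continuous fun p : (ℝ × ℝ) × ℝ => (|p.1.1| + |p.1.2 * p.2|) ^ (H₂ - H₁ - 1) *
      (|p.1.1| + 2 * |p.1.2 * p.2|) :=
    (continuous_rpow_sub_one_mul_add hd).comp
      ((by fun_prop : Continuous fun p : (ℝ × ℝ) × ℝ => (p.1.1, p.1.2 * p.2)))
  refine continuous_iff_continuousAt.2 fun p => ?_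
  unfold profile Function.uncurry
  refine intervalIntegral.continuousAt_of_dominated_interval
    (bound := fun x => (1 - x) ^ (1 / 2 - H₁) * x ^ (H₂ - 3 / 2) *
      (2 * (|p.1| + |p.2| + 2) ^ (H₂ - H₁))) ?_ ?_ (hω.mul_const _) ?_
  · refine Eventually.of_forall fun q => ?_
    refine (aestronglyMeasurable_weight hH₁ hH₁₂ hH₂).mul ?_
    exact (hf.comp (Continuous.prodMk_right q)).aestronglyMeasurable
  · filter_upwards [Metric.ball_mem_nhds p one_pos] with q hq
    refine ae_of_all _ fun x hx => ?_
    rw [uIoc_of_le zero_le_one] at hx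
    have h1x : 0 ≤ 1 - x := by linarith [hx.2]
    have hw : 0 ≤ (1 - x) ^ (1 / 2 - H₁) * x ^ (H₂ - 3 / 2) :=
      mul_nonneg (Real.rpow_nonneg h1x _) (Real.rpow_nonneg hx.1.le _)
    rw [norm_mul, Real.norm_of_nonneg hw, Real.norm_of_nonneg (by positivity)]
    refine mul_le_mul_of_nonneg_left ((rpow_sub_one_mul_add_le hd (abs_nonneg _)
      (abs_nonneg _)).trans ?_) hw
    have hq1 : |q.1 - p.1| < 1 := lt_of_le_of_lt (norm_fst_le (q - p)) (by rwa [← dist_eq_norm])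
    have hq2 : |q.2 - p.2| < 1 := lt_of_le_of_lt (norm_snd_le (q - p)) (by rwa [← dist_eq_norm])
    have h1 : |q.1| ≤ |p.1| + 1 := by linarith [abs_sub_abs_le_abs_sub q.1 p.1]
    have h2 : |q.2 * x| ≤ |p.2| + 1 := by
      rw [abs_mul, abs_of_pos hx.1]
      refine (mul_le_of_le_one_right (abs_nonneg _) hx.2).trans ?_
      linarith [abs_sub_abs_le_abs_sub q.2 p.2]
    gcongr 2 * ?_ ^ _
    linarith
  · refine ae_of_all _ fun x _ => ContinuousAt.mul continuousAt_const ?_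
    exact (hf.comp (Continuous.prodMk_left x)).continuousAt

theorem profile_mul {u : ℝ} (hu : 0 < u) (v w : ℝ) :
    profile H₁ H₂ (u * v) (u * w) = u ^ (H₂ - H₁) * profile H₁ H₂ v w := by
  unfold profile
  rw [← intervalIntegral.integral_const_mul]
  refine intervalIntegral.integral_congr fun x _ => ?_
  simp only [mul_assoc u w x, abs_mul u, abs_of_pos hu, ← mul_add, mul_left_comm 2 u]
  rw [Real.mul_rpow hu.le (by positivity), Real.rpow_sub_one hu.ne']
  field_simp

theorem volterraKernel_eq {t v : ℝ} (hvt : v < t) :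
    volterraKernel H₁ H₂ t v = betaConst H₂ * v ^ (1 / 2 - H₂) * ((t - v) ^ (H₂ - H₁) *
      ∫ x in (0 : ℝ)..1, (1 - x) ^ (1 / 2 - H₁) * x ^ (H₂ - 3 / 2) *
        (v + (t - v) * x) ^ (H₂ - H₁)) := by
  have h0 : 0 < t - v := sub_pos.2 hvt
  unfold volterraKernel
  congr 1
  have hsub := intervalIntegral.integral_comp_mul_add (a := 0) (b := 1)
    (fun u => (t - u) ^ (1 / 2 - H₁) * u ^ (H₂ - H₁) * (u - v) ^ (H₂ - 3 / 2)) h0.ne' v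
  rw [mul_zero, zero_add, mul_one, sub_add_cancel, smul_eq_mul, eq_inv_mul_iff_mul_eq₀ h0.ne']
    at hsub
  rw [← hsub, ← intervalIntegral.integral_const_mul, ← intervalIntegral.integral_const_mul]
  refine intervalIntegral.integral_congr fun x hx => ?_
  rw [uIcc_of_le zero_le_one] at hx
  have e1 : t - ((t - v) * x + v) = (t - v) * (1 - x) := by ring
  have e2 : (t - v) * x + v - v = (t - v) * x := by ring
  have e3 : (t - v) ^ (H₂ - H₁) =
      (t - v) * (t - v) ^ (1 / 2 - H₁) * (t - v) ^ (H₂ - 3 / 2) := by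
    rw [show H₂ - H₁ = 1 + (1 / 2 - H₁) + (H₂ - 3 / 2) by ring, Real.rpow_add h0,
      Real.rpow_add h0, Real.rpow_one]
  simp only [e1, e2]
  rw [Real.mul_rpow h0.le (sub_nonneg.2 hx.2), Real.mul_rpow h0.le hx.1, e3, add_comm v]
  ring

theorem hasDerivAt_weighted_integral (hH₁ : 1 / 2 ≤ H₁) (hH₁₂ : H₁ < H₂) (hH₂ : H₂ < 1)
    {v w : ℝ} (hv : 0 < v) (hw : 0 < w) :
    IntervalIntegrable (fun x => (1 - x) ^ (1 / 2 - H₁) * x ^ (H₂ - 3 / 2) *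
        ((H₂ - H₁) * (v + w * x) ^ (H₂ - H₁ - 1) * x)) volume 0 1 ∧
    HasDerivAt (fun w => ∫ x in (0 : ℝ)..1, (1 - x) ^ (1 / 2 - H₁) * x ^ (H₂ - 3 / 2) *
        (v + w * x) ^ (H₂ - H₁))
      (∫ x in (0 : ℝ)..1, (1 - x) ^ (1 / 2 - H₁) * x ^ (H₂ - 3 / 2) *
        ((H₂ - H₁) * (v + w * x) ^ (H₂ - H₁ - 1) * x)) w := by
  have hd : 0 < H₂ - H₁ := sub_pos.2 hH₁₂
  have hω := intervalIntegrable_weight hH₁ hH₁₂ hH₂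
  have hpow : ∀ w : ℝ, Continuous fun x : ℝ => (v + w * x) ^ (H₂ - H₁) := fun w =>
    (by fun_prop : Continuous fun x : ℝ => v + w * x).rpow_const fun _ => Or.inr hd.le
  refine intervalIntegral.hasDerivAt_integral_of_dominated_loc_of_deriv_le
    (F := fun w x => (1 - x) ^ (1 / 2 - H₁) * x ^ (H₂ - 3 / 2) * (v + w * x) ^ (H₂ - H₁))
    (F' := fun w x => (1 - x) ^ (1 / 2 - H₁) * x ^ (H₂ - 3 / 2) *
      ((H₂ - H₁) * (v + w * x) ^ (H₂ - H₁ - 1) * x))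
    (bound := fun x => (1 - x) ^ (1 / 2 - H₁) * x ^ (H₂ - 3 / 2) *
      ((H₂ - H₁) * v ^ (H₂ - H₁ - 1)))
    (Ioi_mem_nhds hw) (Eventually.of_forall fun w => ?_) ?_ ?_ ?_ (hω.mul_const _) ?_
  · exact (aestronglyMeasurable_weight hH₁ hH₁₂ hH₂).mul (hpow w).aestronglyMeasurable
  · exact hω.mul_continuousOn (hpow w).continuousOn
  · refine (aestronglyMeasurable_weight hH₁ hH₁₂ hH₂).mul (Measurable.aestronglyMeasurable ?_)
    exact (measurable_const.mul ((by fun_prop : Measurable fun x : ℝ => v + w * x).pow_const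
      _)).mul measurable_id
  · refine ae_of_all _ fun x hx y hy => ?_
    rw [uIoc_of_le zero_le_one] at hx
    have hy : 0 < y := hy
    have h1x : 0 ≤ 1 - x := by linarith [hx.2]
    have hx0 := hx.1
    have hw : 0 ≤ (1 - x) ^ (1 / 2 - H₁) * x ^ (H₂ - 3 / 2) :=
      mul_nonneg (Real.rpow_nonneg h1x _) (Real.rpow_nonneg hx.1.le _)
    rw [norm_mul, Real.norm_of_nonneg hw, Real.norm_of_nonneg (by positivity)]
    refine mul_le_mul_of_nonneg_left ?_ hw
    refine (mul_le_of_le_one_right (by positivity) hx.2).trans ?_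
    refine mul_le_mul_of_nonneg_left ?_ hd.le
    exact Real.rpow_le_rpow_of_nonpos hv (by nlinarith) (by linarith)
  · refine ae_of_all _ fun x hx y hy => ?_
    rw [uIoc_of_le zero_le_one] at hx
    have hy : 0 < y := hy
    have hx0 := hx.1
    refine HasDerivAt.const_mul _ ?_
    have h := (((hasDerivAt_id y).mul_const x).const_add v).rpow_const (p := H₂ - H₁)
      (Or.inl (by simp only [id]; positivity))
    simp only [id, one_mul] at h
    exact h.congr_deriv (by ring)

theorem hasDerivAt_volterraKernel (hH₁ : 1 / 2 ≤ H₁) (hH₁₂ : H₁ < H₂) (hH₂ : H₂ < 1)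
    {t v : ℝ} (hv : 0 < v) (hvt : v < t) :
    HasDerivAt (fun t => volterraKernel H₁ H₂ t v)
      (v ^ (1 / 2 - H₂) * (betaConst H₂ * (H₂ - H₁) *
        ((t - v) ^ (H₂ - H₁ - 1) * profile H₁ H₂ v (t - v)))) t := by
  have hd : 0 < H₂ - H₁ := sub_pos.2 hH₁₂
  have hw : 0 < t - v := sub_pos.2 hvt
  have hω := intervalIntegrable_weight hH₁ hH₁₂ hH₂
  obtain ⟨hint, hG⟩ := hasDerivAt_weighted_integral hH₁ hH₁₂ hH₂ hv hw
  have hsub : HasDerivAt (fun t : ℝ => t - v) 1 t := (hasDerivAt_id t).sub_const v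
  have hG' := hG.comp t hsub
  have hpow := hsub.rpow_const (p := H₂ - H₁) (Or.inl hw.ne')
  have hfull := (hpow.mul hG').const_mul (betaConst H₂ * v ^ (1 / 2 - H₂))
  have heq : (fun t => volterraKernel H₁ H₂ t v) =ᶠ[𝓝 t] fun t =>
      betaConst H₂ * v ^ (1 / 2 - H₂) * ((t - v) ^ (H₂ - H₁) *
      ∫ x in (0 : ℝ)..1, (1 - x) ^ (1 / 2 - H₁) * x ^ (H₂ - 3 / 2) *
        (v + (t - v) * x) ^ (H₂ - H₁)) := by
    filter_upwards [Ioi_mem_nhds hvt] with t ht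
    exact volterraKernel_eq ht
  refine (hfull.congr_of_eventuallyEq heq).congr_deriv ?_
  have hint0 : IntervalIntegrable (fun x => (1 - x) ^ (1 / 2 - H₁) * x ^ (H₂ - 3 / 2) *
      (v + (t - v) * x) ^ (H₂ - H₁)) volume 0 1 :=
    hω.mul_continuousOn ((by fun_prop : Continuous fun x : ℝ => v + (t - v) * x).rpow_const
      fun _ => Or.inr hd.le).continuousOn
  have hprof : (H₂ - H₁) * profile H₁ H₂ v (t - v) =
      (H₂ - H₁) * (∫ x in (0 : ℝ)..1, (1 - x) ^ (1 / 2 - H₁) * x ^ (H₂ - 3 / 2) *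
        (v + (t - v) * x) ^ (H₂ - H₁)) +
      (t - v) * ∫ x in (0 : ℝ)..1, (1 - x) ^ (1 / 2 - H₁) * x ^ (H₂ - 3 / 2) *
        ((H₂ - H₁) * (v + (t - v) * x) ^ (H₂ - H₁ - 1) * x) := by
    unfold profile
    rw [← intervalIntegral.integral_const_mul, ← intervalIntegral.integral_const_mul,
      ← intervalIntegral.integral_const_mul,
      ← intervalIntegral.integral_add (hint0.const_mul _) (hint.const_mul _)]
    refine intervalIntegral.integral_congr fun x hx => ?_
    rw [uIcc_of_le zero_le_one] at hx
    have hwx : 0 ≤ (t - v) * x := mul_nonneg hw.le hx.1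
    have hm : 0 < v + (t - v) * x := by linarith
    have key : ∀ m y R : ℝ, m ≠ 0 → v = m - y → R / m * (v + 2 * y) = R + y * (R / m) := by
      intro m y R hm hv
      rw [hv]
      field_simp
      ring
    simp only [abs_of_pos hv, abs_of_nonneg hwx]
    rw [Real.rpow_sub_one hm.ne', key _ _ _ hm.ne' (by ring)]
    ring
  have hpow1 : (t - v) ^ (H₂ - H₁) = (t - v) * (t - v) ^ (H₂ - H₁ - 1) := by
    rw [Real.rpow_sub_one hw.ne']; field_simp
  simp only [Function.comp_apply, mul_one, one_mul]
  rw [hpow1]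
  linear_combination -(betaConst H₂ * v ^ (1 / 2 - H₂) * (t - v) ^ (H₂ - H₁ - 1)) * hprof

end

section

variable {H₁ H₂ T : ℝ}

/-- The kernel `v ^ (H₂ - 1/2) * ∂K(s, v)/∂s`, extended by zero to `s ≤ v`. -/
noncomputable def reducedKernel (H₁ H₂ v s : ℝ) : ℝ :=
  singularKernel (H₂ - H₁ - 1) (fun v w => betaConst H₂ * (H₂ - H₁) * profile H₁ H₂ v w) v s

theorem continuous_const_mul_profile (hH₁ : 1 / 2 ≤ H₁) (hH₁₂ : H₁ < H₂) (hH₂ : H₂ < 1) :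
    Continuous (Function.uncurry
      fun v w => betaConst H₂ * (H₂ - H₁) * profile H₁ H₂ v w) :=
  continuous_const.mul (continuous_profile hH₁ hH₁₂ hH₂)

theorem reducedKernel_of_lt {v s : ℝ} (h : v < s) : reducedKernel H₁ H₂ v s =
    (s - v) ^ (H₂ - H₁ - 1) * (betaConst H₂ * (H₂ - H₁) * profile H₁ H₂ v (s - v)) :=
  if_pos h

theorem reducedKernel_of_le {v s : ℝ} (h : s ≤ v) : reducedKernel H₁ H₂ v s = 0 :=
  if_neg (not_lt.2 h)

theorem deriv_volterraKernel (hH₁ : 1 / 2 ≤ H₁) (hH₁₂ : H₁ < H₂) (hH₂ : H₂ < 1)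
    {s v : ℝ} (hv : 0 < v) (hvs : v < s) :
    deriv (fun t => volterraKernel H₁ H₂ t v) s =
      v ^ (1 / 2 - H₂) * reducedKernel H₁ H₂ v s := by
  rw [(hasDerivAt_volterraKernel hH₁ hH₁₂ hH₂ hv hvs).deriv, reducedKernel_of_lt hvs]
  ring

theorem reducedKernel_mul {u : ℝ} (hu : 0 < u) (r s : ℝ) :
    reducedKernel H₁ H₂ (u * r) (u * s) =
      u ^ (2 * (H₂ - H₁) - 1) * reducedKernel H₁ H₂ r s := by
  rcases lt_or_ge r s with h | h
  · rw [reducedKernel_of_lt h, reducedKernel_of_lt (mul_lt_mul_of_pos_left h hu), ← mul_sub,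
      profile_mul hu, Real.mul_rpow hu.le (sub_nonneg.2 h.le),
      show 2 * (H₂ - H₁) - 1 = (H₂ - H₁ - 1) + (H₂ - H₁) by ring, Real.rpow_add hu]
    ring
  · rw [reducedKernel_of_le h, reducedKernel_of_le (mul_le_mul_of_nonneg_left h hu.le), mul_zero]

theorem measurable_reducedKernel (hH₁ : 1 / 2 ≤ H₁) (hH₁₂ : H₁ < H₂) (hH₂ : H₂ < 1) :
    Measurable (Function.uncurry (reducedKernel H₁ H₂)) :=
  measurable_singularKernel (continuous_const_mul_profile hH₁ hH₁₂ hH₂)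

theorem integrableOn_reducedKernel (hH₁ : 1 / 2 ≤ H₁) (hH₁₂ : H₁ < H₂) (hH₂ : H₂ < 1)
    {v : ℝ} (hv : v ∈ Icc 0 T) : IntegrableOn (reducedKernel H₁ H₂ v) (Icc 0 T) :=
  integrableOn_singularKernel (by linarith) (by linarith)
    (continuous_const_mul_profile hH₁ hH₁₂ hH₂) hv

theorem exists_setIntegral_abs_reducedKernel_le (hH₁ : 1 / 2 ≤ H₁) (hH₁₂ : H₁ < H₂)
    (hH₂ : H₂ < 1) (T : ℝ) :
    ∃ M, ∀ v ∈ Icc 0 T, ∫ s in Icc 0 T, |reducedKernel H₁ H₂ v s| ≤ M := by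
  have ha : -1 < H₂ - H₁ - 1 := by linarith
  obtain ⟨M, hM0, hM⟩ := exists_bound_of_continuous
    (continuous_const_mul_profile hH₁ hH₁₂ hH₂) T
  refine ⟨M * ∫ w in Ioo 0 (|T| + 1), w ^ (H₂ - H₁ - 1), fun v hv => ?_⟩
  have hT : 0 ≤ |T| + 1 := by positivity
  have hi := (integrable_indicator_comp_sub ha hT v).const_mul M
  calc ∫ s in Icc 0 T, |reducedKernel H₁ H₂ v s|
      ≤ ∫ s in Icc 0 T, M * (Ioo 0 (|T| + 1)).indicator (fun w => w ^ (H₂ - H₁ - 1)) (s - v) := by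
        refine setIntegral_mono_on (integrableOn_reducedKernel hH₁ hH₁₂ hH₂ hv).abs
          hi.integrableOn measurableSet_Icc fun s hs => ?_
        rcases lt_or_ge v s with h | h
        · have h0 : 0 < s - v := sub_pos.2 h
          rw [reducedKernel_of_lt h, indicator_of_mem
            (show s - v ∈ Ioo 0 (|T| + 1) from ⟨h0, by linarith [hs.2, hv.1, le_abs_self T]⟩),
            abs_mul, abs_of_nonneg (Real.rpow_nonneg h0.le _), mul_comm]
          exact mul_le_mul_of_nonneg_right (hM v hv _
            ⟨by linarith [hv.2, hs.1], by linarith [hs.2, hv.1]⟩) (Real.rpow_nonneg h0.le _)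
        · rw [reducedKernel_of_le h, abs_zero]
          exact mul_nonneg hM0 (indicator_nonneg (fun w hw => Real.rpow_nonneg hw.1.le _) _)
    _ ≤ ∫ s, M * (Ioo 0 (|T| + 1)).indicator (fun w => w ^ (H₂ - H₁ - 1)) (s - v) := by
        refine setIntegral_le_integral hi (ae_of_all _ fun s => ?_)
        exact mul_nonneg hM0 (indicator_nonneg (fun w hw => Real.rpow_nonneg hw.1.le _) _)
    _ = _ := by
        rw [integral_const_mul, integral_sub_right_eq_self
          (fun w => (Ioo 0 (|T| + 1)).indicator (fun w : ℝ => w ^ (H₂ - H₁ - 1)) w),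
          integral_indicator measurableSet_Ioo]

theorem continuousOn_reducedKernel_left (hH₁ : 1 / 2 ≤ H₁) (hH₁₂ : H₁ < H₂) (hH₂ : H₂ < 1)
    (s : ℝ) : ContinuousOn (fun v => reducedKernel H₁ H₂ v s) (Iio s) := by
  have hP := continuous_const_mul_profile hH₁ hH₁₂ hH₂
  have h : ContinuousOn (fun v => (s - v) ^ (H₂ - H₁ - 1) *
      (betaConst H₂ * (H₂ - H₁) * profile H₁ H₂ v (s - v))) (Iio s) := by
    refine ContinuousOn.mul ?_ ?_
    · exact (by fun_prop : Continuous fun v => s - v).continuousOn.rpow_const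
        fun v hv => Or.inl (sub_pos.2 hv).ne'
    · exact (hP.comp (by fun_prop : Continuous fun v : ℝ => (v, s - v))).continuousOn
  exact h.congr fun v hv => reducedKernel_of_lt hv

/-- The dilation density `r ^ (1 - 2 H₂) * reducedKernel r 1`. -/
noncomputable def dilationWeight (H₁ H₂ r : ℝ) : ℝ :=
  r ^ (1 - 2 * H₂) * reducedKernel H₁ H₂ r 1

theorem intervalIntegrable_dilationWeight (hH₁ : 1 / 2 ≤ H₁) (hH₁₂ : H₁ < H₂) (hH₂ : H₂ < 1) :
    IntervalIntegrable (dilationWeight H₁ H₂) volume 0 1 := by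
  have hP := continuous_const_mul_profile hH₁ hH₁₂ hH₂
  have h := (intervalIntegrable_beta_weight (a := H₂ - H₁ - 1) (b := 1 - 2 * H₂)
    (by linarith) (by linarith)).mul_continuousOn
    (hP.comp (by fun_prop : Continuous fun v : ℝ => (v, 1 - v))).continuousOn
  rw [intervalIntegrable_iff_integrableOn_Ioo_of_le zero_le_one] at h ⊢
  refine h.congr_fun (fun r hr => ?_) measurableSet_Ioo
  simp only [dilationWeight, reducedKernel_of_lt hr.2, Function.comp_apply, Function.uncurry]
  ring

theorem rpow_mul_reducedKernel_mul {u r : ℝ} (hu : 0 < u) (hr : 0 ≤ r) :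
    u ^ (2 * H₁ - 1) * (u * ((u * r) ^ (1 - 2 * H₂) * reducedKernel H₁ H₂ (u * r) u)) =
      dilationWeight H₁ H₂ r := by
  have h := reducedKernel_mul (H₁ := H₁) (H₂ := H₂) hu r 1
  rw [mul_one] at h
  rw [h, Real.mul_rpow hu.le hr, dilationWeight]
  have hone : u ^ (2 * H₁ - 1) * u * u ^ (1 - 2 * H₂) * u ^ (2 * (H₂ - H₁) - 1) = 1 := by
    rw [← Real.rpow_add_one hu.ne', ← Real.rpow_add hu, ← Real.rpow_add hu]
    convert Real.rpow_zero u using 2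
    ring
  linear_combination (r ^ (1 - 2 * H₂) * reducedKernel H₁ H₂ r 1) * hone

theorem setIntegral_Ioo_mul_reducedKernel {u : ℝ} (huT : u ≤ T) (f : ℝ → ℝ) :
    ∫ v in Ioo 0 T, f v * reducedKernel H₁ H₂ v u =
      ∫ v in Ioo 0 u, f v * reducedKernel H₁ H₂ v u := by
  refine setIntegral_eq_of_subset_of_forall_sdiff_eq_zero measurableSet_Ioo
    (Ioo_subset_Ioo_right huT) fun v hv => ?_
  rw [reducedKernel_of_le (not_lt.1 fun h => hv.2 ⟨hv.1.1, h⟩), mul_zero]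

theorem integrableOn_rpow_mul_reducedKernel (hH₁ : 1 / 2 ≤ H₁) (hH₁₂ : H₁ < H₂) (hH₂ : H₂ < 1)
    {u : ℝ} (hu : 0 < u) :
    IntegrableOn (fun v => v ^ (1 - 2 * H₂) * reducedKernel H₁ H₂ v u) (Ioo 0 T) := by
  have h := ((intervalIntegrable_dilationWeight hH₁ hH₁₂ hH₂).comp_mul_left
    (c := u⁻¹)).const_mul ((u ^ (2 * H₁ - 1) * u)⁻¹)
  rw [zero_div, div_inv_eq_mul, one_mul,
    intervalIntegrable_iff_integrableOn_Ioo_of_le hu.le] at h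
  have h' : IntegrableOn (fun v => v ^ (1 - 2 * H₂) * reducedKernel H₁ H₂ v u) (Ioo 0 u) := by
    refine h.congr_fun (fun v hv => ?_) measurableSet_Ioo
    have hpos : 0 < u ^ (2 * H₁ - 1) := Real.rpow_pos_of_pos hu _
    simp only [← rpow_mul_reducedKernel_mul hu (mul_nonneg (inv_nonneg.2 hu.le) hv.1.le),
      mul_inv_cancel_left₀ hu.ne']
    field_simp
  refine h'.of_forall_sdiff_eq_zero measurableSet_Ioo fun v hv => ?_
  rw [reducedKernel_of_le (not_lt.1 fun h => hv.2 ⟨hv.1.1, h⟩), mul_zero]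

theorem rpow_mul_setIntegral_reducedKernel {u : ℝ} (hu : 0 < u) (huT : u ≤ T) (g : ℝ → ℝ) :
    u ^ (2 * H₁ - 1) * ∫ v in Ioo 0 T, v ^ (1 - 2 * H₂) * g v * reducedKernel H₁ H₂ v u =
      ∫ r in (0 : ℝ)..1, dilationWeight H₁ H₂ r * g (u * r) := by
  rw [setIntegral_Ioo_mul_reducedKernel huT, ← integral_Ioc_eq_integral_Ioo,
    ← intervalIntegral.integral_of_le hu.le]
  have hsub := intervalIntegral.integral_comp_mul_left (a := 0) (b := 1)
    (fun v => v ^ (1 - 2 * H₂) * g v * reducedKernel H₁ H₂ v u) hu.ne'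
  rw [mul_zero, mul_one, smul_eq_mul, eq_inv_mul_iff_mul_eq₀ hu.ne'] at hsub
  rw [← hsub, ← mul_assoc, ← intervalIntegral.integral_const_mul]
  refine intervalIntegral.integral_congr fun r hr => ?_
  rw [uIcc_of_le zero_le_one] at hr
  simp only [← rpow_mul_reducedKernel_mul (H₁ := H₁) (H₂ := H₂) hu hr.1]
  ring

theorem kernelK_eq (hH₁ : 1 / 2 ≤ H₁) (hH₁₂ : H₁ < H₂) (hH₂ : H₂ < 1)
    {s u : ℝ} (hs : s ∈ Icc 0 T) (hu : u ∈ Icc 0 T) :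
    kernelK H₁ H₂ s u = ∫ v in Ioo 0 T,
      v ^ (1 - 2 * H₂) * reducedKernel H₁ H₂ v s * reducedKernel H₁ H₂ v u := by
  unfold kernelK
  rw [intervalIntegral.integral_of_le (le_min hs.1 hu.1), integral_Ioc_eq_integral_Ioo,
    setIntegral_eq_of_subset_of_forall_sdiff_eq_zero (s := Ioo 0 (min s u)) measurableSet_Ioo
    (Ioo_subset_Ioo_right ((min_le_left s u).trans hs.2))]
  · refine setIntegral_congr_fun measurableSet_Ioo fun v hv => ?_
    simp only [deriv_volterraKernel hH₁ hH₁₂ hH₂ hv.1 (hv.2.trans_le (min_le_left _ _)),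
      deriv_volterraKernel hH₁ hH₁₂ hH₂ hv.1 (hv.2.trans_le (min_le_right _ _))]
    rw [show 1 - 2 * H₂ = (1 / 2 - H₂) + (1 / 2 - H₂) by ring, Real.rpow_add hv.1]
    ring
  · intro v hv
    rcases min_le_iff.1 (not_lt.1 fun h => hv.2 ⟨hv.1.1, h⟩) with h | h
    · rw [reducedKernel_of_le h, mul_zero, zero_mul]
    · rw [reducedKernel_of_le h, mul_zero]

theorem integrable_prod_reducedKernel (hH₁ : 1 / 2 ≤ H₁) (hH₁₂ : H₁ < H₂) (hH₂ : H₂ < 1)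
    {f q : ℝ → ℝ} (hf : Continuous f) (hq : IntegrableOn q (Ioo 0 T)) :
    Integrable (fun p : ℝ × ℝ => f p.1 * (q p.2 * reducedKernel H₁ H₂ p.2 p.1))
      ((volume.restrict (Icc 0 T)).prod (volume.restrict (Ioo 0 T))) := by
  obtain ⟨M, hM⟩ := exists_setIntegral_abs_reducedKernel_le hH₁ hH₁₂ hH₂ T
  obtain ⟨F, hF⟩ := (isCompact_Icc (a := (0 : ℝ)) (b := T)).exists_bound_of_continuousOn
    hf.continuousOn
  have hmeas : AEStronglyMeasurable
      (fun p : ℝ × ℝ => f p.1 * (q p.2 * reducedKernel H₁ H₂ p.2 p.1))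
      ((volume.restrict (Icc 0 T)).prod (volume.restrict (Ioo 0 T))) := by
    refine (hf.comp continuous_fst).aestronglyMeasurable.mul
      (hq.aestronglyMeasurable.comp_snd.mul (Measurable.aestronglyMeasurable ?_))
    exact (measurable_reducedKernel hH₁ hH₁₂ hH₂).comp measurable_swap
  have hslice : ∀ v ∈ Ioo 0 T, IntegrableOn
      (fun s => f s * (q v * reducedKernel H₁ H₂ v s)) (Icc 0 T) := fun v hv =>
    IntegrableOn.continuousOn_mul hf.continuousOn
      ((integrableOn_reducedKernel hH₁ hH₁₂ hH₂ (Ioo_subset_Icc_self hv)).const_mul (q v))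
      isCompact_Icc
  refine (integrable_prod_iff' hmeas).2 ⟨?_, ?_⟩
  · filter_upwards [ae_restrict_mem measurableSet_Ioo] with v hv using hslice v hv
  · refine Integrable.mono' (hq.norm.mul_const (F * M)) hmeas.norm.prod_swap.integral_prod_right' ?_
    filter_upwards [ae_restrict_mem measurableSet_Ioo] with v hv
    have hv' := Ioo_subset_Icc_self hv
    have hF0 : 0 ≤ F := (norm_nonneg _).trans (hF v hv')
    rw [Real.norm_of_nonneg (integral_nonneg fun _ => norm_nonneg _)]
    calc ∫ s in Icc 0 T, ‖f s * (q v * reducedKernel H₁ H₂ v s)‖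
        ≤ ∫ s in Icc 0 T, (‖q v‖ * F) * |reducedKernel H₁ H₂ v s| := by
          refine setIntegral_mono_on (hslice v hv).norm
            ((integrableOn_reducedKernel hH₁ hH₁₂ hH₂ hv').abs.const_mul _) measurableSet_Icc
            fun s hs => ?_
          rw [norm_mul, norm_mul, Real.norm_eq_abs (reducedKernel _ _ _ _), mul_comm ‖q v‖ F,
            mul_assoc]
          exact mul_le_mul_of_nonneg_right (hF s hs) (by positivity)
      _ ≤ ‖q v‖ * (F * M) := by
          rw [integral_const_mul, mul_assoc]
          exact mul_le_mul_of_nonneg_left (mul_le_mul_of_nonneg_left (hM v hv') hF0)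
            (norm_nonneg _)

theorem setIntegral_swap_reducedKernel (hH₁ : 1 / 2 ≤ H₁) (hH₁₂ : H₁ < H₂) (hH₂ : H₂ < 1)
    {f q : ℝ → ℝ} (hf : Continuous f) (hq : IntegrableOn q (Ioo 0 T)) :
    ∫ s in Icc 0 T, f s * ∫ v in Ioo 0 T, q v * reducedKernel H₁ H₂ v s =
      ∫ v in Ioo 0 T, q v * ∫ s in Icc 0 T, f s * reducedKernel H₁ H₂ v s := by
  simp only [← integral_const_mul]
  rw [integral_integral_swap (integrable_prod_reducedKernel hH₁ hH₁₂ hH₂ hf hq)]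
  simp only [mul_left_comm]

theorem kappa_of_pos (hH₁ : 1 / 2 ≤ H₁) (hH₁₂ : H₁ < H₂) (hH₂ : H₂ < 1)
    {s u : ℝ} (hs : s ∈ Icc 0 T) (hu : 0 < u) (huT : u ≤ T) :
    kappa H₁ H₂ s u = u ^ (2 * H₁ - 1) * ∫ v in Ioo 0 T,
      v ^ (1 - 2 * H₂) * reducedKernel H₁ H₂ v u * reducedKernel H₁ H₂ v s := by
  rw [kappa, if_neg hu.ne', kernelK_eq hH₁ hH₁₂ hH₂ hs ⟨hu.le, huT⟩]
  simp only [mul_right_comm _ (reducedKernel H₁ H₂ _ s)]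

theorem kappa_zero (hH₁ : 1 / 2 ≤ H₁) (hH₁₂ : H₁ < H₂) (hH₂ : H₂ < 1) {s : ℝ} (hs : 0 < s) :
    kappa H₁ H₂ s 0 =
      (∫ r in (0 : ℝ)..1, dilationWeight H₁ H₂ r) * reducedKernel H₁ H₂ 0 s := by
  rw [kappa, if_pos rfl]
  refine Tendsto.limUnder_eq ?_
  have hρ := intervalIntegrable_dilationWeight hH₁ hH₁₂ hH₂
  have hcont := continuousOn_reducedKernel_left hH₁ hH₁₂ hH₂ s
  obtain ⟨C, hC⟩ := (isCompact_Icc (a := (0 : ℝ)) (b := s / 2)).exists_bound_of_continuousOn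
    (hcont.mono fun v hv => show v < s by linarith [hv.2])
  have hnear : ∀ᶠ w in 𝓝[>] (0 : ℝ), w ∈ Ioo 0 (s / 2) := Ioo_mem_nhdsGT (by positivity)
  have hlim : Tendsto (fun w => ∫ r in (0 : ℝ)..1,
      dilationWeight H₁ H₂ r * reducedKernel H₁ H₂ (w * r) s) (𝓝[>] 0)
      (𝓝 (∫ r in (0 : ℝ)..1, dilationWeight H₁ H₂ r * reducedKernel H₁ H₂ 0 s)) := by
    refine intervalIntegral.tendsto_integral_filter_of_dominated_convergence
      (fun r => ‖dilationWeight H₁ H₂ r‖ * C) ?_ ?_ (hρ.norm.mul_const C) ?_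
    · refine Eventually.of_forall fun w => ?_
      rw [uIoc_of_le zero_le_one]
      refine hρ.1.aestronglyMeasurable.mul (Measurable.aestronglyMeasurable ?_)
      exact (measurable_reducedKernel hH₁ hH₁₂ hH₂).comp
        ((measurable_const_mul w).prodMk measurable_const)
    · filter_upwards [hnear] with w hw
      refine ae_of_all _ fun r hr => ?_
      rw [uIoc_of_le zero_le_one] at hr
      rw [norm_mul]
      refine mul_le_mul_of_nonneg_left (hC _ ⟨mul_nonneg hw.1.le hr.1.le, ?_⟩) (norm_nonneg _)
      exact (mul_le_of_le_one_right hw.1.le hr.2).trans hw.2.le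
    · refine ae_of_all _ fun r _ => Tendsto.const_mul _ ?_
      have h0 : ContinuousAt (fun v => reducedKernel H₁ H₂ v s) 0 :=
        hcont.continuousAt (Iio_mem_nhds hs)
      refine h0.tendsto.comp (Tendsto.mono_left ?_ nhdsWithin_le_nhds)
      simpa using ((continuous_mul_const r).tendsto (0 : ℝ))
  rw [intervalIntegral.integral_mul_const] at hlim
  refine hlim.congr' ?_
  filter_upwards [hnear] with w hw
  have hws : w ≤ s := by linarith [hw.1, hw.2]
  rw [kernelK_eq (T := s) hH₁ hH₁₂ hH₂ ⟨hs.le, le_rfl⟩ ⟨hw.1.le, hws⟩,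
    rpow_mul_setIntegral_reducedKernel hw.1 hws fun v => reducedKernel H₁ H₂ v s]

/-- Integration against `kappa` factors as the Volterra operator followed by dilation averaging. -/
theorem setIntegral_mul_kappa (hH₁ : 1 / 2 ≤ H₁) (hH₁₂ : H₁ < H₂) (hH₂ : H₂ < 1)
    {f : ℝ → ℝ} (hf : Continuous f) {u : ℝ} (hu : u ∈ Icc 0 T) :
    IntegrableOn (fun s => f s * kappa H₁ H₂ s u) (Icc 0 T) ∧
      ∫ s in Icc 0 T, f s * kappa H₁ H₂ s u = ∫ r in (0 : ℝ)..1, dilationWeight H₁ H₂ r *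
        ∫ s in Icc 0 T, f s * reducedKernel H₁ H₂ (u * r) s := by
  rcases hu.1.eq_or_lt with rfl | hu0
  · have hae : (fun s => (∫ r in (0 : ℝ)..1, dilationWeight H₁ H₂ r) *
        (f s * reducedKernel H₁ H₂ 0 s)) =ᵐ[volume.restrict (Icc 0 T)]
        fun s => f s * kappa H₁ H₂ s 0 := by
      rw [← restrict_Ioc_eq_restrict_Icc]
      filter_upwards [ae_restrict_mem measurableSet_Ioc] with s hs
      rw [kappa_zero hH₁ hH₁₂ hH₂ hs.1]
      ring
    have hi : IntegrableOn (fun s => f s * reducedKernel H₁ H₂ 0 s) (Icc 0 T) :=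
      IntegrableOn.continuousOn_mul hf.continuousOn
        (integrableOn_reducedKernel hH₁ hH₁₂ hH₂ hu) isCompact_Icc
    refine ⟨(hi.const_mul _).congr hae, ?_⟩
    rw [← integral_congr_ae hae, integral_const_mul, ← intervalIntegral.integral_mul_const]
    simp only [zero_mul]
  · have hq := integrableOn_rpow_mul_reducedKernel (T := T) hH₁ hH₁₂ hH₂ hu0
    have hprod := integrable_prod_reducedKernel hH₁ hH₁₂ hH₂ hf hq
    have heq : ∀ s ∈ Icc 0 T, u ^ (2 * H₁ - 1) * (f s * ∫ v in Ioo 0 T,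
        v ^ (1 - 2 * H₂) * reducedKernel H₁ H₂ v u * reducedKernel H₁ H₂ v s) =
        f s * kappa H₁ H₂ s u := fun s hs => by
      rw [kappa_of_pos hH₁ hH₁₂ hH₂ hs hu0 hu.2]
      ring
    constructor
    · have h := hprod.integral_prod_left.const_mul (u ^ (2 * H₁ - 1))
      simp only [integral_const_mul] at h
      exact IntegrableOn.congr_fun h heq measurableSet_Icc
    · rw [← setIntegral_congr_fun measurableSet_Icc heq, integral_const_mul,
        setIntegral_swap_reducedKernel hH₁ hH₁₂ hH₂ hf hq,
        ← rpow_mul_setIntegral_reducedKernel hu0 hu.2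
          fun v => ∫ s in Icc 0 T, f s * reducedKernel H₁ H₂ v s]
      simp only [mul_right_comm _ (reducedKernel H₁ H₂ _ u)]

/-- The averaging operator over dilations is bounded on `C([0, T])`. -/
theorem exists_dilation_operator {ρ : ℝ → ℝ} (hρ : IntervalIntegrable ρ volume 0 1)
    (hT : 0 ≤ T) :
    ∃ C : C(Icc (0 : ℝ) T, ℝ) →L[ℝ] C(Icc (0 : ℝ) T, ℝ), ∀ g u,
      C g u = ∫ r in (0 : ℝ)..1, ρ r * IccExtend hT g (u * r) := by
  have hext : ∀ g : C(Icc (0 : ℝ) T, ℝ), Continuous (IccExtend hT g) := fun g =>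
    g.continuous.Icc_extend'
  have hint : ∀ (g : C(Icc (0 : ℝ) T, ℝ)) (u : ℝ),
      IntervalIntegrable (fun r => ρ r * IccExtend hT g (u * r)) volume 0 1 := fun g u =>
    hρ.mul_continuousOn ((hext g).comp (continuous_const_mul u)).continuousOn
  have hle : ∀ (g : C(Icc (0 : ℝ) T, ℝ)) (u r : ℝ),
      ‖ρ r * IccExtend hT g (u * r)‖ ≤ ‖ρ r‖ * ‖g‖ := fun g u r => by
    rw [norm_mul]
    exact mul_le_mul_of_nonneg_left (g.norm_coe_le_norm _) (norm_nonneg _)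
  have hcont : ∀ g : C(Icc (0 : ℝ) T, ℝ),
      Continuous fun u : ℝ => ∫ r in (0 : ℝ)..1, ρ r * IccExtend hT g (u * r) := by
    intro g
    refine intervalIntegral.continuous_of_dominated_interval (bound := fun r => ‖ρ r‖ * ‖g‖)
      (fun u => ?_) (fun u => ae_of_all _ fun r _ => hle g u r) (hρ.norm.mul_const _)
      (ae_of_all _ fun r _ => continuous_const.mul ((hext g).comp (continuous_mul_const r)))
    rw [uIoc_of_le zero_le_one]
    exact (hint g u).1.aestronglyMeasurable
  refine ⟨LinearMap.mkContinuous
    { toFun := fun g => ⟨fun u => ∫ r in (0 : ℝ)..1, ρ r * IccExtend hT g (u * r),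
        (hcont g).comp continuous_subtype_val⟩
      map_add' := fun f g => ?_
      map_smul' := fun a f => ?_ } (∫ r in (0 : ℝ)..1, ‖ρ r‖) fun g => ?_, fun g u => rfl⟩
  · ext u
    simp only [ContinuousMap.add_apply, ContinuousMap.coe_mk]
    rw [← intervalIntegral.integral_add (hint f u) (hint g u)]
    simp only [IccExtend_apply, ContinuousMap.add_apply, mul_add]
  · ext u
    simp only [ContinuousMap.smul_apply, ContinuousMap.coe_mk, RingHom.id_apply, smul_eq_mul]
    rw [← intervalIntegral.integral_const_mul]
    simp only [IccExtend_apply, ContinuousMap.smul_apply, smul_eq_mul, mul_left_comm a]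
  · refine (ContinuousMap.norm_le _ (mul_nonneg (intervalIntegral.integral_nonneg zero_le_one
      fun _ _ => norm_nonneg _) (norm_nonneg g))).2 fun u => ?_
    rw [← intervalIntegral.integral_mul_const]
    exact (intervalIntegral.norm_integral_le_integral_norm zero_le_one).trans
      (intervalIntegral.integral_mono_on zero_le_one (hint g u).norm (hρ.norm.mul_const _)
        fun r _ => hle g u r)

/-- Positivity of `kappa` as a quadratic form: the homogeneous equation has no nonzero solution. -/
theorem eq_zero_of_homogeneous (hH₁ : 1 / 2 ≤ H₁) (hH₁₂ : H₁ < H₂) (hH₂ : H₂ < 1)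
    (hT : 0 < T) {c : ℝ} (hc : 0 ≤ c) {f g : ℝ → ℝ} (hf : Continuous f) (hg : Continuous g)
    (hgf : ∀ v ∈ Icc 0 T, g v = ∫ s in Icc 0 T, f s * reducedKernel H₁ H₂ v s)
    (hfg : ∀ u ∈ Icc 0 T,
      f u + c * ∫ r in (0 : ℝ)..1, dilationWeight H₁ H₂ r * g (u * r) = 0) :
    EqOn f 0 (Icc 0 T) := by
  have hq : IntegrableOn (fun v : ℝ => v ^ (1 - 2 * H₂) * g v) (Ioo 0 T) :=
    (intervalIntegrable_iff_integrableOn_Ioo_of_le hT.le).1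
      ((intervalIntegral.intervalIntegrable_rpow' (by linarith)).mul_continuousOn hg.continuousOn)
  have hsq : IntegrableOn (fun u : ℝ => u ^ (1 - 2 * H₁) * f u ^ 2) (Ioc 0 T) :=
    (intervalIntegrable_iff_integrableOn_Ioc_of_le hT.le).1
      ((intervalIntegral.intervalIntegrable_rpow' (by linarith)).mul_continuousOn
        (hf.pow 2).continuousOn)
  have hpt : ∀ u ∈ Ioc 0 T, u ^ (1 - 2 * H₁) * f u ^ 2 = -c * (f u * ∫ v in Ioo 0 T,
      v ^ (1 - 2 * H₂) * g v * reducedKernel H₁ H₂ v u) := by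
    intro u hu
    have h := hfg u (Ioc_subset_Icc_self hu)
    rw [← rpow_mul_setIntegral_reducedKernel hu.1 hu.2] at h
    have hone : u ^ (1 - 2 * H₁) * u ^ (2 * H₁ - 1) = 1 := by
      rw [← Real.rpow_add hu.1]
      convert Real.rpow_zero u using 2
      ring
    linear_combination (u ^ (1 - 2 * H₁) * f u) * h - (c * f u * ∫ v in Ioo 0 T,
      v ^ (1 - 2 * H₂) * g v * reducedKernel H₁ H₂ v u) * hone
  have hnonpos : ∫ u in Ioc 0 T, u ^ (1 - 2 * H₁) * f u ^ 2 ≤ 0 := by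
    rw [setIntegral_congr_fun measurableSet_Ioc hpt, integral_const_mul,
      ← integral_Icc_eq_integral_Ioc, setIntegral_swap_reducedKernel hH₁ hH₁₂ hH₂ hf hq, neg_mul,
      neg_nonpos]
    refine mul_nonneg hc (setIntegral_nonneg measurableSet_Ioo fun v hv => ?_)
    rw [← hgf v (Ioo_subset_Icc_self hv), mul_assoc]
    exact mul_nonneg (Real.rpow_nonneg hv.1.le _) (mul_self_nonneg _)
  have hnn : ∀ u ∈ Ioc 0 T, 0 ≤ u ^ (1 - 2 * H₁) * f u ^ 2 := fun u hu =>
    mul_nonneg (Real.rpow_nonneg hu.1.le _) (sq_nonneg _)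
  have hzero := (setIntegral_eq_zero_iff_of_nonneg_ae (ae_restrict_of_forall_mem
    measurableSet_Ioc hnn) hsq).1 (le_antisymm hnonpos (setIntegral_nonneg measurableSet_Ioc hnn))
  refine Measure.eqOn_Icc_of_ae_eq volume hT.ne ?_ hf.continuousOn continuousOn_const
  rw [← restrict_Ioc_eq_restrict_Icc]
  filter_upwards [hzero, ae_restrict_mem measurableSet_Ioc] with u hu hu'
  have hu : u ^ (1 - 2 * H₁) * f u ^ 2 = 0 := hu
  simpa [(Real.rpow_pos_of_pos hu'.1 _).ne'] using hu

/-- The Fredholm equation is uniquely solvable in `C([0, T])` for every `T > 0`. -/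
theorem existsUnique_isFredholmSolution (hH₁ : 1 / 2 ≤ H₁) (hH₁₂ : H₁ < H₂) (hH₂ : H₂ < 1)
    (hT : 0 < T) : ∃! h : C(Icc (0 : ℝ) T, ℝ), IsFredholmSolution H₁ H₂ T h := by
  obtain ⟨B, hBc, hB⟩ := exists_isCompactOperator_singularKernel (a := H₂ - H₁ - 1)
    (by linarith) (by linarith) (continuous_const_mul_profile hH₁ hH₁₂ hH₂) T
  obtain ⟨C, hC⟩ := exists_dilation_operator
    (intervalIntegrable_dilationWeight hH₁ hH₁₂ hH₂) hT.le
  have hext : ∀ g : C(Icc (0 : ℝ) T, ℝ), Continuous (IccExtend hT.le g) := fun g =>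
    g.continuous.Icc_extend'
  have hBext : ∀ h : C(Icc (0 : ℝ) T, ℝ), ∀ v ∈ Icc 0 T, IccExtend hT.le (B h) v =
      ∫ s in Icc 0 T, IccExtend hT.le h s * reducedKernel H₁ H₂ v s := by
    intro h v hv
    rw [IccExtend_of_mem _ _ hv, hB, ← integral_subtype_comap measurableSet_Icc]
    simp only [IccExtend_val]
    rfl
  have hCB : ∀ (h : C(Icc (0 : ℝ) T, ℝ)) (u : Icc (0 : ℝ) T),
      Integrable (fun s : Icc (0 : ℝ) T => h s * kappa H₁ H₂ s u)
        ((volume : Measure ℝ).comap Subtype.val) ∧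
      ∫ s : Icc (0 : ℝ) T, h s * kappa H₁ H₂ s u ∂((volume : Measure ℝ).comap Subtype.val) =
        C (B h) u := by
    intro h u
    obtain ⟨hi, he⟩ := setIntegral_mul_kappa hH₁ hH₁₂ hH₂ (hext h) u.2
    rw [integrableOn_iff_comap_subtypeVal measurableSet_Icc] at hi
    rw [← integral_subtype_comap measurableSet_Icc] at he
    simp only [IccExtend_val, Function.comp_def] at hi he
    refine ⟨hi, ?_⟩
    rw [he, hC]
    refine intervalIntegral.integral_congr fun r hr => ?_
    rw [uIcc_of_le zero_le_one] at hr
    simp only [hBext h (u * r) ⟨mul_nonneg u.2.1 hr.1,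
      (mul_le_of_le_one_right u.2.1 hr.2).trans u.2.2⟩]
  set c : ℝ := 1 / gammaConst H₁ ^ 2 with hcdef
  have hc : 0 ≤ c := by positivity
  have hiff : ∀ h, IsFredholmSolution H₁ H₂ T h ↔ h + c • C (B h) = 1 := by
    intro h
    rw [ContinuousMap.ext_iff]
    refine forall_congr' fun u => ?_
    rw [(hCB h u).2, and_iff_right (hCB h u).1]
    rfl
  let A : C(Icc (0 : ℝ) T, ℝ) →L[ℝ] C(Icc (0 : ℝ) T, ℝ) := -(c • (C.comp B))
  have hA : IsCompactOperator A := ((hBc.clm_comp C).smul c).neg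
  have hAapp : ∀ h, h - A h = h + c • C (B h) := fun h => by simp [A]
  have hres : (1 : ℝ) ∈ resolventSet ℝ A := by
    refine (hA.hasEigenvalue_or_mem_resolventSet one_ne_zero).resolve_left fun hev => ?_
    obtain ⟨h, hh⟩ := hev.exists_hasEigenvector
    have hh1 : A h = h := by simpa using hh.apply_eq_smul
    have hh2 := hAapp h
    rw [hh1, sub_self] at hh2
    have hz := eq_zero_of_homogeneous hH₁ hH₁₂ hH₂ hT hc (hext h) (hext (B h)) (hBext h)
      fun u hu => by
        have := congrArg (fun k : C(Icc (0 : ℝ) T, ℝ) => k ⟨u, hu⟩) hh2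
        simp only [ContinuousMap.add_apply, ContinuousMap.smul_apply, smul_eq_mul, hC,
          ContinuousMap.zero_apply] at this
        rw [IccExtend_of_mem _ _ hu]
        exact this.symm
    refine hh.2 (ContinuousMap.ext fun u => ?_)
    have := hz u.2
    rwa [IccExtend_val] at this
  rw [spectrum.mem_resolventSet_iff, ContinuousLinearMap.isUnit_iff_bijective] at hres
  obtain ⟨h, hh, huniq⟩ := hres.existsUnique 1
  have happ : ∀ h, (algebraMap ℝ (C(Icc (0 : ℝ) T, ℝ) →L[ℝ] C(Icc (0 : ℝ) T, ℝ)) 1 - A) h =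
      h + c • C (B h) := fun h => by
    rw [map_one, ← hAapp]
    rfl
  exact ⟨h, (hiff h).2 (by rw [← happ]; exact hh), fun k hk =>
    huniq k (by rw [← (hiff k).1 hk]; exact happ k)⟩

end

end MixedFBM

theorem theorem1 (H₁ H₂ : ℝ) (hH₁ : 1 / 2 ≤ H₁) (hH₁₂ : H₁ < H₂) (hH₂ : H₂ < 1) :
    ∃ T : ℕ → ℝ, (∀ n, 0 < T n) ∧ Filter.Tendsto T Filter.atTop Filter.atTop ∧
      ∀ n, ∃! h : C(Set.Icc (0 : ℝ) (T n), ℝ), MixedFBM.IsFredholmSolution H₁ H₂ (T n) h :=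
  ⟨fun n => n + 1, fun n => by positivity,
    Filter.tendsto_atTop_add_const_right _ _ tendsto_natCast_atTop_atTop,
    fun n => MixedFBM.existsUnique_isFredholmSolution hH₁ hH₁₂ hH₂ (by positivity)⟩
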